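/- For $x\in\mathbb R^2$ let $K(x)=\dfrac{x^\perp}{2\pi|x|^2}$ with $(x_1,x_2)^\perp=(-x_2,x_1)$ be the Biot–Savart kernel, and let $B^+(0;r)=\{x\in\mathbb R^2: |x|<r,\ x_2>0\}$. For $\alpha\in\mathbb R$ put $$\omega^\alpha_+(x)=\frac{1}{|x|\,|\log|x||^{\alpha}}\,\chi_{B^+(0;1/3)}(x),\qquad u^\alpha_+=K*\omega^\alpha_+ .$$ (1) If $\alpha<1$, then the integral defining $u^\alpha_+(x)$ converges absolutely for every $x\neq0$, and $u^\alpha_+$ is a measurable function that is (essentially) unbounded: $\|u^\alpha_+\|_{L^\infty(\mathbb R^2)}=\infty$. Moreover there are constants $C>0$ and $r_0>0$ (depending on $\alpha$) such that the first component $u_1$ of $u^\alpha_+$ satisfies $$u_1(x)\ \ge\ C\,|\log|x||^{1-\alpha}\qquad\text{for all }x\in B^+(0;r_0).$$ (2) If $1/2<\alpha\le 2/3$, then $u^\alpha_+\,|\omega^\alpha_+|^2$ is not locally integrable on $\mathbb R^2$. -/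

import Mathlib

open MeasureTheory
open scoped ENNReal Convolution

noncomputable section

/-- The Euclidean plane; `x 0` and `x 1` are the coordinates written `x₁` and `x₂` on paper. -/
abbrev Plane : Type := EuclideanSpace ℝ (Fin 2)

/-- `x^⊥ = (-x₂, x₁)`. -/
def perp (x : Plane) : Plane := !₂[-x 1, x 0]

/-- The Biot–Savart kernel `K(x) = x^⊥ / (2π|x|²)`. -/
def biotSavartKernel (x : Plane) : Plane := (2 * Real.pi * ‖x‖ ^ 2)⁻¹ • perp x

/-- The pairing `(v, s) ↦ s v` of a vector and a scalar, used to convolve `K` with a vorticity. -/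
def vecScalar : Plane →L[ℝ] ℝ →L[ℝ] Plane :=
  (ContinuousLinearMap.lsmul ℝ ℝ : ℝ →L[ℝ] Plane →L[ℝ] Plane).flip

/-- The velocity `K ∗ ω` of a vorticity `ω`. -/
def velocity (ω : Plane → ℝ) : Plane → Plane :=
  biotSavartKernel ⋆[vecScalar, volume] ω

/-- The open upper half-disk `B⁺(0; r) = B(0; r) ∩ {x₂ > 0}`. -/
def upperHalfDisk (r : ℝ) : Set Plane := Metric.ball 0 r ∩ {x | 0 < x 1}

/-- `ω^α_+ (x) = (|x| |log |x||^α)⁻¹` on `B⁺(0; 1/3)`, and `0` elsewhere. -/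
def omegaPlus (α : ℝ) : Plane → ℝ :=
  (upperHalfDisk (1 / 3)).indicator fun x => (‖x‖ * |Real.log ‖x‖| ^ α)⁻¹

end

/-! ### Radial functions on the plane -/

/-! The first velocity component at `x` is `(2π)⁻¹ ∫ (y₂ - x₂) / |x - y|² ω(y) dy`. The vorticity
lives where `y₂ > 0`, so distant mass contributes with one sign, and nothing cancels the logarithmic
divergence at the origin. Split the integral at `|y| = R = 10|x|`.

Far from `x` the kernel is close to `y₂ / |y|²` (`far_kernel_ge`). Reflection and coordinate
exchange reduce half-plane integrals to radial ones (`integral_upper_mul_ge`, `integral_upper_le`),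
and what remains is `∫_R^{1/3} dr / (r |log r|^α)`, of order `|log R|^(1-α)`.

Near the singularities `0` and `x` the integrand is bounded in absolute value. There `ω(y) ≤ R^(1/2)
|log R|^(-α) |y|^(-3/2)` (`inv_mul_log_le`), and scale invariance (`singular_error_eq`) leaves an
error of order `|log R|^(-α)`, one full power of the logarithm below the main term.

For the second claim, `|ω|² u₁` is at least a constant times `|x|⁻² |log |x||^(1-3α)` on a
half-disk. For `α ≤ 2/3` this dominates `|x|⁻² |log |x||⁻¹`, whose planar integral diverges like `∫
dr / (r |log r|)`. -/

theorem integrable_radial_iff {f : ℝ → ℝ} :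
    Integrable (fun z : Plane => f ‖z‖) ↔ IntegrableOn (fun r => r * f r) (Set.Ioi 0) := by
  simpa using integrable_fun_norm_addHaar (volume : Measure Plane) (f := f)

theorem integral_radial (f : ℝ → ℝ) :
    ∫ z : Plane, f ‖z‖ =
      2 * (volume : Measure Plane).real (Metric.ball 0 1) * ∫ r in Set.Ioi 0, r * f r := by
  simpa [mul_assoc] using integral_fun_norm_addHaar (volume : Measure Plane) f

theorem volume_unitBall_pos : 0 < (volume : Measure Plane).real (Metric.ball 0 1) :=
  ENNReal.toReal_pos (Metric.measure_ball_pos _ _ one_pos).ne' measure_ball_lt_top.ne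

/-- The power `r ^ (-s)` cut off to the ball of radius `R`. -/
noncomputable def cutPower (s R : ℝ) : ℝ → ℝ := (Set.Iio R).indicator fun r => r ^ (-s)

theorem cutPower_nonneg {s R r : ℝ} (hr : 0 ≤ r) : 0 ≤ cutPower s R r :=
  Set.indicator_apply_nonneg fun _ => Real.rpow_nonneg hr _

theorem cutPower_of_lt {s R r : ℝ} (h : r < R) : cutPower s R r = r ^ (-s) :=
  Set.indicator_of_mem (Set.mem_Iio.2 h) _

theorem mul_cutPower {s R r : ℝ} (hr : 0 < r) :
    r * cutPower s R r = (Set.Iio R).indicator (fun r => r ^ (1 - s)) r := by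
  unfold cutPower
  by_cases h : r ∈ Set.Iio R
  · simp only [Set.indicator_of_mem h]
    rw [sub_eq_add_neg, Real.rpow_add hr, Real.rpow_one]
  · simp [Set.indicator_of_notMem h]

theorem Ioi_inter_Iio_eq (R : ℝ) : Set.Ioi 0 ∩ Set.Iio R = Set.Ioo 0 R := rfl

theorem integrable_cutPower {s R : ℝ} (hs : s < 2) (hR : 0 < R) :
    Integrable fun z : Plane => cutPower s R ‖z‖ := by
  have h : Set.EqOn (fun r => r * cutPower s R r) ((Set.Iio R).indicator fun r => r ^ (1 - s))
      (Set.Ioi 0) := fun r hr => mul_cutPower hr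
  rw [integrable_radial_iff, integrableOn_congr_fun h measurableSet_Ioi,
    IntegrableOn, integrable_indicator_iff measurableSet_Iio, IntegrableOn,
    Measure.restrict_restrict measurableSet_Iio, Set.inter_comm, Ioi_inter_Iio_eq]
  exact (intervalIntegral.integrableOn_Ioo_rpow_iff hR).2 (by linarith)

theorem integral_cutPower {s R : ℝ} (hs : s < 2) (hR : 0 < R) :
    ∫ z : Plane, cutPower s R ‖z‖ =
      2 * (volume : Measure Plane).real (Metric.ball 0 1) * (R ^ (2 - s) / (2 - s)) := by
  rw [integral_radial, setIntegral_congr_fun measurableSet_Ioi (fun r hr => mul_cutPower hr),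
    setIntegral_indicator measurableSet_Iio, Ioi_inter_Iio_eq, ← integral_Ioc_eq_integral_Ioo,
    ← intervalIntegral.integral_of_le hR.le, integral_rpow (Or.inl (by linarith)),
    show 1 - s + 1 = 2 - s by ring, Real.zero_rpow (by linarith), sub_zero]

/-! ### Averages over the upper half-plane -/

theorem plane_neg_apply (z : Plane) (i : Fin 2) : (-z) i = -z i := rfl

/-- Exchange of the two coordinates. -/
noncomputable def coordSwap : Plane ≃ₗᵢ[ℝ] Plane :=
  LinearIsometryEquiv.piLpCongrLeft 2 ℝ ℝ (Equiv.swap 0 1)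

theorem coordSwap_one (z : Plane) : coordSwap z 1 = z 0 := by
  simp [coordSwap, LinearIsometryEquiv.piLpCongrLeft_apply, Equiv.piCongrLeft']

theorem norm_le_abs_add_abs (z : Plane) : ‖z‖ ≤ |z 0| + |z 1| := by
  rw [EuclideanSpace.norm_eq, Fin.sum_univ_two]
  apply Real.sqrt_le_iff.2
  simp only [Real.norm_eq_abs]
  exact ⟨by positivity, by nlinarith [abs_nonneg (z 0), abs_nonneg (z 1)]⟩

theorem abs_apply_le_norm (z : Plane) (i : Fin 2) : |z i| ≤ ‖z‖ := by
  simpa using PiLp.norm_apply_le z i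

theorem upper_add_upper_neg (z : Plane) (f : ℝ) :
    ({z : Plane | 0 < z 1}.indicator (fun z => z 1 * f) z) +
      ({z : Plane | 0 < z 1}.indicator (fun z => z 1 * f) (-z)) = |z 1| * f := by
  have hm (w : Plane) : w ∈ {z : Plane | 0 < z 1} ↔ 0 < w 1 := Iff.rfl
  have hn : -z ∈ {z : Plane | 0 < z 1} ↔ z 1 < 0 := by rw [hm, plane_neg_apply, neg_pos]
  rcases lt_trichotomy (z 1) 0 with h | h | h
  · rw [Set.indicator_of_notMem (by rw [hm]; linarith), Set.indicator_of_mem (hn.2 h),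
      plane_neg_apply, abs_of_neg h, zero_add]
  · rw [Set.indicator_of_notMem (by rw [hm]; linarith),
      Set.indicator_of_notMem (by rw [hn]; linarith)]
    simp [h]
  · rw [Set.indicator_of_mem ((hm z).2 h), Set.indicator_of_notMem (by rw [hn]; linarith),
      abs_of_pos h, add_zero]

theorem measurableSet_upper : MeasurableSet {z : Plane | 0 < z 1} :=
  measurableSet_lt measurable_const (by fun_prop)

/-- A radial function times the vertical coordinate: integrability over the upper half-plane
implies integrability of the radial function. -/
theorem integrable_norm_mul_of_upper {f : ℝ → ℝ} (hf : Measurable f)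
    (h : Integrable ({z : Plane | 0 < z 1}.indicator fun z => z 1 * f ‖z‖)) :
    Integrable fun z : Plane => ‖z‖ * f ‖z‖ := by
  -- Reflection through the origin fills in the lower half-plane; exchanging coordinates then treats
  -- `z 0`, and `|z 0| + |z 1|` dominates `‖z‖`.
  have h1 : Integrable fun z : Plane => |z 1| * f ‖z‖ := by
    refine (h.add h.comp_neg).congr (.of_forall fun z => ?_)
    simpa [Set.indicator_apply] using upper_add_upper_neg z (f ‖z‖)
  have h2 : Integrable fun z : Plane => |z 0| * f ‖z‖ := by
    refine (coordSwap.measurePreserving.integrable_comp_of_integrable h1).congr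
      (.of_forall fun z => ?_)
    simp [coordSwap_one]
  refine (h1.add h2).mono (by fun_prop) (.of_forall fun z => ?_)
  simp only [Pi.add_apply, norm_mul, norm_norm, ← add_mul]
  gcongr
  rw [Real.norm_of_nonneg (by positivity)]
  linarith [norm_le_abs_add_abs z]

/-- Half of the constant comes from restricting to the upper half-plane, half from `‖z‖ ≤ |z 0| + |z
1|`, whose two terms have equal integrals by symmetry. -/
theorem integral_upper_mul_ge {f : ℝ → ℝ} (hf : ∀ r, 0 ≤ r → 0 ≤ f r) (hm : Measurable f)
    (hi : Integrable fun z : Plane => ‖z‖ * f ‖z‖) :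
    (1 / 4) * ∫ z : Plane, ‖z‖ * f ‖z‖ ≤
      ∫ z : Plane, {z : Plane | 0 < z 1}.indicator (fun z => z 1 * f ‖z‖) z := by
  have hc (i : Fin 2) : Integrable fun z : Plane => |z i| * f ‖z‖ := by
    refine hi.mono (by fun_prop) (.of_forall fun z => ?_)
    simp only [norm_mul, Real.norm_eq_abs, abs_abs]
    exact mul_le_mul_of_nonneg_right (by simpa using abs_apply_le_norm z i) (abs_nonneg _)
  have hu : Integrable ({z : Plane | 0 < z 1}.indicator fun z => z 1 * f ‖z‖) := by
    refine Integrable.indicator ?_ measurableSet_upper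
    exact (hc 1).mono (by fun_prop) (.of_forall fun z => by simp)
  have h1 : ∫ z : Plane, |z 1| * f ‖z‖ =
      2 * ∫ z : Plane, {z : Plane | 0 < z 1}.indicator (fun z => z 1 * f ‖z‖) z := by
    have e : ∀ z : Plane, |z 1| * f ‖z‖ =
        ({z : Plane | 0 < z 1}.indicator (fun z => z 1 * f ‖z‖) z) +
        ({z : Plane | 0 < z 1}.indicator (fun z => z 1 * f ‖z‖) (-z)) := fun z => by
      rw [← upper_add_upper_neg z (f ‖z‖)]
      simp [Set.indicator_apply]
    rw [integral_congr_ae (.of_forall e), integral_add hu hu.comp_neg,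
      integral_neg_eq_self _ volume]
    ring
  have h0 : ∫ z : Plane, |z 0| * f ‖z‖ = ∫ z : Plane, |z 1| * f ‖z‖ := by
    rw [← coordSwap.measurePreserving.integral_comp
      coordSwap.toHomeomorph.measurableEmbedding (fun z : Plane => |z 1| * f ‖z‖)]
    simp [coordSwap_one]
  have h2 : ∫ z : Plane, ‖z‖ * f ‖z‖ ≤
      (∫ z : Plane, |z 0| * f ‖z‖) + ∫ z : Plane, |z 1| * f ‖z‖ := by
    rw [← integral_add (hc 0) (hc 1)]
    refine integral_mono hi ((hc 0).add (hc 1)) fun z => ?_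
    simp only [← add_mul]
    exact mul_le_mul_of_nonneg_right (norm_le_abs_add_abs z) (hf _ (norm_nonneg _))
  linarith

theorem integral_upper_le {f : ℝ → ℝ} (hf : ∀ r, 0 ≤ r → 0 ≤ f r)
    (hi : Integrable fun z : Plane => f ‖z‖) :
    ∫ z : Plane, {z : Plane | 0 < z 1}.indicator (fun z => f ‖z‖) z ≤
      (1 / 2) * ∫ z : Plane, f ‖z‖ := by
  have hu := hi.indicator measurableSet_upper
  have h : ∫ z : Plane, {z : Plane | 0 < z 1}.indicator (fun z => f ‖z‖) z +
      {z : Plane | 0 < z 1}.indicator (fun z => f ‖z‖) (-z) ≤ ∫ z : Plane, f ‖z‖ := by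
    refine integral_mono (hu.add hu.comp_neg) hi fun z => ?_
    have := hf ‖z‖ (norm_nonneg z)
    simp only [Set.indicator_apply, Set.mem_ofPred_eq, plane_neg_apply, norm_neg]
    split_ifs <;> linarith
  rw [integral_add hu hu.comp_neg, integral_neg_eq_self _ volume] at h
  linarith

/-! ### Logarithmic weights -/

/-- With `t = -log r` this is the monotonicity of `r^(1/2) |log r|^(-α)` near `0`. It follows from
`q ≤ exp (q - 1)` at `q = t / T`, since `|α| / T ≤ 1/2`. -/
theorem rpow_neg_le_mul_exp {α T t : ℝ} (hT : 0 < T) (hα : 2 * |α| ≤ T) (ht : T ≤ t) :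
    t ^ (-α) ≤ T ^ (-α) * Real.exp ((t - T) / 2) := by
  have hq : 1 ≤ t / T := (one_le_div hT).2 ht
  have e : t = T * (t / T) := by field_simp
  calc t ^ (-α) = T ^ (-α) * (t / T) ^ (-α) := by
        rw [← Real.mul_rpow hT.le (by positivity), ← e]
    _ ≤ T ^ (-α) * (t / T) ^ |α| := by
        gcongr ?_ * ?_
        exact Real.rpow_le_rpow_of_exponent_le hq (neg_le_abs α)
    _ ≤ T ^ (-α) * Real.exp (t / T - 1) ^ |α| := by
        gcongr
        linarith [Real.add_one_le_exp (t / T - 1)]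
    _ ≤ T ^ (-α) * Real.exp ((t - T) / 2) := by
        rw [← Real.exp_mul]
        gcongr
        have : t / T - 1 = (t - T) / T := by field_simp
        rw [this, div_mul_eq_mul_div, div_le_div_iff₀ hT two_pos]
        nlinarith

theorem abs_log_of_lt_one {r : ℝ} (h0 : 0 < r) (h1 : r < 1) : |Real.log r| = -Real.log r :=
  abs_of_neg (Real.log_neg h0 h1)

theorem one_lt_neg_log {r : ℝ} (h0 : 0 < r) (h1 : r < 1 / 3) : 1 < -Real.log r := by
  rw [← Real.log_inv, Real.lt_log_iff_exp_lt (by positivity)]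
  have : 3 < r⁻¹ := by rw [lt_inv_comm₀ (by norm_num) h0]; linarith
  linarith [Real.exp_one_lt_d9]

theorem rpow_neg_three_halves {r : ℝ} (h : 0 < r) :
    r ^ (-(3 / 2) : ℝ) = r⁻¹ * Real.exp (-Real.log r / 2) := by
  rw [show (-(3 / 2) : ℝ) = -1 + -(1 / 2) by norm_num, Real.rpow_add h, Real.rpow_neg_one,
    Real.rpow_def_of_pos h]
  ring_nf

/-- Half a power of `r` is given up to freeze the logarithm at `R`. Keeping the factor `(-log
R)^(-α)` is what makes the near-field error of lower order. -/
theorem inv_mul_log_le {α R r : ℝ} (hr : 0 < r) (hrR : r ≤ R) (hR : R < 1)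
    (hα : 2 * |α| ≤ -Real.log R) :
    (r * |Real.log r| ^ α)⁻¹ ≤ R ^ (1 / 2 : ℝ) * (-Real.log R) ^ (-α) * r ^ (-(3 / 2) : ℝ) := by
  have hR0 : 0 < R := hr.trans_le hrR
  have hT : 0 < -Real.log R := neg_pos.2 (Real.log_neg hR0 hR)
  have ht : -Real.log R ≤ -Real.log r := neg_le_neg (Real.log_le_log hr hrR)
  have key := rpow_neg_le_mul_exp hT hα ht
  rw [abs_log_of_lt_one hr (hrR.trans_lt hR), mul_inv, ← Real.rpow_neg (hT.le.trans ht),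
    rpow_neg_three_halves hr, Real.rpow_def_of_pos hR0]
  calc r⁻¹ * (-Real.log r) ^ (-α)
      ≤ r⁻¹ * ((-Real.log R) ^ (-α) * Real.exp ((-Real.log r - -Real.log R) / 2)) := by gcongr
    _ = _ := by
        rw [show (-Real.log r - -Real.log R) / 2 = Real.log R * (1 / 2) + -Real.log r / 2 by ring,
          Real.exp_add]
        ring

theorem exists_inv_mul_log_le (α : ℝ) : ∃ B, 0 ≤ B ∧ ∀ r, 0 < r → r < 1 / 3 →
    (r * |Real.log r| ^ α)⁻¹ ≤ B * r ^ (-(3 / 2) : ℝ) := by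
  set T := max 1 (2 * |α|)
  have hT1 : 1 ≤ T := le_max_left _ _
  refine ⟨T ^ |α|, by positivity, fun r h0 h1 => ?_⟩
  have ht := one_lt_neg_log h0 h1
  rw [abs_log_of_lt_one h0 (by linarith), mul_inv, ← Real.rpow_neg (by linarith),
    rpow_neg_three_halves h0]
  set t := -Real.log r
  have h : t ^ (-α) ≤ T ^ |α| * Real.exp (t / 2) := by
    calc t ^ (-α) ≤ t ^ |α| := Real.rpow_le_rpow_of_exponent_le ht.le (neg_le_abs α)
      _ ≤ T ^ |α| * Real.exp (t / 2) := by
        rcases le_total t T with h | h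
        · calc t ^ |α| ≤ T ^ |α| * 1 := by rw [mul_one]; gcongr
            _ ≤ _ := by gcongr; exact Real.one_le_exp (by linarith)
        · have := rpow_neg_le_mul_exp (α := -|α|) (by linarith) (by simp [T]) h
          rw [neg_neg] at this
          refine this.trans ?_
          gcongr
          linarith
  calc r⁻¹ * t ^ (-α) ≤ r⁻¹ * (T ^ |α| * Real.exp (t / 2)) := by gcongr
    _ = _ := by ring

theorem hasDerivAt_neg_log_rpow {α r : ℝ} (hα : α < 1) (h0 : 0 < r) (h1 : r < 1) :
    HasDerivAt (fun r => -((-Real.log r) ^ (1 - α) / (1 - α))) (r⁻¹ * |Real.log r| ^ (-α)) r := by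
  have hl : -Real.log r ≠ 0 := (neg_pos.2 (Real.log_neg h0 h1)).ne'
  have := ((((Real.hasDerivAt_log h0.ne').neg).rpow_const (p := 1 - α)
    (Or.inl hl)).div_const (1 - α)).neg
  convert! this using 1
  have : 1 - α ≠ 0 := by linarith
  rw [abs_log_of_lt_one h0 h1, show 1 - α - 1 = -α by ring]
  field_simp
  rfl

theorem continuousOn_inv_mul_log {α R : ℝ} (hR : 0 < R) :
    ContinuousOn (fun r => r⁻¹ * |Real.log r| ^ (-α)) (Set.Icc R (1 / 3)) := by
  have h0 : ∀ r ∈ Set.Icc R (1 / 3), r ≠ 0 := fun r hr => (hR.trans_le hr.1).ne'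
  refine (continuousOn_id.inv₀ h0).mul
    ((continuousOn_id.log h0).abs.rpow_const fun r hr => Or.inl ?_)
  rw [id, abs_log_of_lt_one (hR.trans_le hr.1) (by linarith [hr.2])]
  exact (neg_pos.2 (Real.log_neg (hR.trans_le hr.1) (by linarith [hr.2]))).ne'

theorem integral_inv_mul_log {α R : ℝ} (hα : α < 1) (hR : 0 < R) (hR' : R ≤ 1 / 3) :
    ∫ r in R..(1 / 3), r⁻¹ * |Real.log r| ^ (-α) =
      ((-Real.log R) ^ (1 - α) - Real.log 3 ^ (1 - α)) / (1 - α) := by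
  have hd : ∀ r ∈ Set.uIcc R (1 / 3), HasDerivAt
      (fun r => -((-Real.log r) ^ (1 - α) / (1 - α))) (r⁻¹ * |Real.log r| ^ (-α)) r := by
    rw [Set.uIcc_of_le hR']
    exact fun r hr => hasDerivAt_neg_log_rpow hα (hR.trans_le hr.1) (by linarith [hr.2])
  rw [intervalIntegral.integral_eq_sub_of_hasDerivAt hd
    ((continuousOn_inv_mul_log hR).intervalIntegrable_of_Icc hR'),
    show -Real.log (1 / 3) = Real.log 3 by rw [one_div, Real.log_inv, neg_neg]]
  ring

/-- The primitive `-log (-log r)` is unbounded at `0`. -/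
theorem not_integrableOn_inv_mul_inv_log {ρ : ℝ} (hρ : 0 < ρ) (hρ' : ρ ≤ 1 / 3) :
    ¬ IntegrableOn (fun r => r⁻¹ * (-Real.log r)⁻¹) (Set.Ioo 0 ρ) := by
  have hd : ∀ r ∈ Set.Ioo 0 ρ,
      HasDerivAt (fun r => -Real.log (-Real.log r)) (r⁻¹ * (-Real.log r)⁻¹) r := fun r hr => by
    have hl : -Real.log r ≠ 0 := by linarith [one_lt_neg_log hr.1 (hr.2.trans_le hρ')]
    convert! ((Real.hasDerivAt_log hr.1.ne').neg.log hl).neg using 1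
    rw [Pi.neg_apply, neg_div, neg_neg, div_eq_mul_inv]
  have hmem : Set.Ioo 0 ρ ∈ nhdsWithin (0 : ℝ) (Set.Ioi 0) := Ioo_mem_nhdsGT hρ
  refine not_integrableOn_of_tendsto_norm_atTop_of_deriv_isBigO_filter
    (nhdsWithin 0 (Set.Ioi 0)) (f := fun r => -Real.log (-Real.log r)) hmem
    ?_ ?_ ?_
  · filter_upwards [hmem] with r hr using (hd r hr).differentiableAt
  · refine Filter.Tendsto.congr (fun r => (norm_neg _).symm) ?_
    refine tendsto_norm_atTop_atTop.comp (Real.tendsto_log_atTop.comp ?_)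
    exact Filter.tendsto_neg_atBot_atTop.comp Real.tendsto_log_nhdsGT_zero
  · refine Asymptotics.IsBigO.of_bound 1 ?_
    filter_upwards [hmem] with r hr
    rw [(hd r hr).deriv, one_mul]

/-- Since `Λ^(1-α) = Λ · Λ^(-α)`, each of the two errors is eventually at most a quarter of the main
term. -/
theorem exists_log_dominates {α c k D : ℝ} (hα : α < 1) (hc : 0 < c) :
    ∃ Λ₀ > 0, ∀ Λ ≥ Λ₀, c / 2 * Λ ^ (1 - α) ≤ c * (Λ ^ (1 - α) - k) - D * Λ ^ (-α) := by
  have h1 := (tendsto_rpow_atTop (y := 1 - α) (by linarith)).eventually_ge_atTop (4 * k)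
  have h2 := Filter.eventually_ge_atTop (4 * |D| / c)
  obtain ⟨Λ₀, h⟩ := Filter.eventually_atTop.1 ((h1.and h2).and (Filter.eventually_gt_atTop 0))
  refine ⟨max Λ₀ 1, by positivity, fun Λ hΛ => ?_⟩
  obtain ⟨⟨hk, hD⟩, h0⟩ := h Λ ((le_max_left _ _).trans hΛ)
  rw [div_le_iff₀ hc] at hD
  have e : Λ ^ (1 - α) = Λ * Λ ^ (-α) := by
    rw [sub_eq_add_neg, Real.rpow_add h0, Real.rpow_one]
  have hp : 0 ≤ Λ ^ (-α) := Real.rpow_nonneg h0.le _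
  have : D * Λ ^ (-α) ≤ c / 4 * Λ ^ (1 - α) := by
    rw [e]
    nlinarith [le_abs_self D]
  nlinarith

/-! ### Pointwise bounds for the Biot–Savart integrand -/

theorem norm_perp (x : Plane) : ‖perp x‖ = ‖x‖ := by
  simp [EuclideanSpace.norm_eq, perp, Fin.sum_univ_two, add_comm]

theorem norm_biotSavartKernel (z : Plane) :
    ‖biotSavartKernel z‖ = (2 * Real.pi)⁻¹ * ‖z‖⁻¹ := by
  have := Real.pi_pos
  rw [biotSavartKernel, norm_smul, norm_perp, Real.norm_of_nonneg (by positivity)]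
  rcases eq_or_ne ‖z‖ 0 with h | h
  · simp [h]
  · field_simp

theorem biotSavartKernel_zero (z : Plane) :
    biotSavartKernel z 0 = (2 * Real.pi)⁻¹ * (-z 1 / ‖z‖ ^ 2) := by
  simp [biotSavartKernel, perp, div_eq_mul_inv]
  ring

theorem vecScalar_apply (v : Plane) (s : ℝ) : vecScalar v s = s • v := rfl

theorem measurable_biotSavartKernel : Measurable biotSavartKernel := by
  have : Continuous perp := by
    unfold perp
    fun_prop
  unfold biotSavartKernel
  have hn : Measurable fun x : Plane => (2 * Real.pi * ‖x‖ ^ 2)⁻¹ := by fun_prop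
  exact hn.smul this.measurable

theorem measurableSet_upperHalfDisk (r : ℝ) : MeasurableSet (upperHalfDisk r) :=
  measurableSet_ball.inter measurableSet_upper

theorem measurable_omegaPlus (α : ℝ) : Measurable (omegaPlus α) :=
  Measurable.indicator (f := fun x : Plane => (‖x‖ * |Real.log ‖x‖| ^ α)⁻¹) (by
    have : Measurable fun x : Plane => |Real.log ‖x‖| :=
      continuous_abs.measurable.comp (Real.measurable_log.comp measurable_norm)
    exact (measurable_norm.mul (this.pow_const α)).inv) (measurableSet_upperHalfDisk _)

theorem omegaPlus_nonneg (α : ℝ) (y : Plane) : 0 ≤ omegaPlus α y :=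
  Set.indicator_nonneg (fun _ _ => by positivity) y

theorem mem_upperHalfDisk {r : ℝ} {y : Plane} : y ∈ upperHalfDisk r ↔ ‖y‖ < r ∧ 0 < y 1 := by
  rw [upperHalfDisk, Set.mem_inter_iff, mem_ball_zero_iff]
  rfl

theorem norm_pos_of_upper {y : Plane} (h : 0 < y 1) : 0 < ‖y‖ :=
  (abs_pos.2 h.ne').trans_le (abs_apply_le_norm y 1)

/-- One of `a`, `b` is at least `ρ / 2`, so its factor can be replaced by a constant. This separates
the singularities at `x` and `0`. -/
theorem inv_mul_rpow_le {ρ a b : ℝ} (hρ : 0 < ρ) (ha : 0 ≤ a) (hb : 0 ≤ b) (h : ρ ≤ a + b) :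
    a⁻¹ * b ^ (-(3 / 2) : ℝ) ≤
      2 / ρ * b ^ (-(3 / 2) : ℝ) + (2 / ρ) ^ (3 / 2 : ℝ) * a⁻¹ := by
  have h1 : 0 ≤ b ^ (-(3 / 2) : ℝ) := Real.rpow_nonneg hb _
  have h2 : 0 ≤ (2 / ρ) ^ (3 / 2 : ℝ) := by positivity
  have h3 : 0 ≤ a⁻¹ := inv_nonneg.2 ha
  rcases le_total (ρ / 2) a with h' | h'
  · have : a⁻¹ ≤ 2 / ρ := by
      rw [← inv_div]
      exact inv_anti₀ (by positivity) h'
    nlinarith [mul_nonneg h2 h3]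
  · have : b ^ (-(3 / 2) : ℝ) ≤ (2 / ρ) ^ (3 / 2 : ℝ) := by
      rw [← inv_div ρ 2, Real.inv_rpow (by positivity), ← Real.rpow_neg (by positivity)]
      exact Real.rpow_le_rpow_of_nonpos (by positivity) (by linarith) (by norm_num)
    nlinarith [mul_nonneg (div_nonneg zero_le_two hρ.le) h1]

/-- The distance `d` lies between `9n/10` and `11n/10`. The ratio `10` is large enough that, after
averaging, `(1/4)(100/121)` still exceeds `(1/2)(10/81)`. -/
theorem far_kernel_ge {n ρ d y x : ℝ} (hn : 0 < n) (h : 10 * ρ ≤ n) (hy : 0 ≤ y)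
    (hx : |x| ≤ ρ) (h1 : n - ρ ≤ d) (h2 : d ≤ n + ρ) :
    100 / 121 * (y / n ^ 2) - 10 / 81 * n⁻¹ ≤ (y - x) / d ^ 2 := by
  have hd : 0 < d := by linarith
  have hd1 : d ^ 2 ≤ 121 / 100 * n ^ 2 := by nlinarith
  have hd2 : 81 / 100 * n ^ 2 ≤ d ^ 2 := by nlinarith
  have e1 : 100 / 121 * (y / n ^ 2) ≤ y / d ^ 2 := by
    rw [show 100 / 121 * (y / n ^ 2) = y / (121 / 100 * n ^ 2) by field_simp]
    gcongr
  have e2 : x / d ^ 2 ≤ 10 / 81 * n⁻¹ := by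
    rw [show 10 / 81 * n⁻¹ = (n / 10) / (81 / 100 * n ^ 2) by field_simp; norm_num]
    gcongr
    linarith [le_abs_self x]
  rw [sub_div]
  linarith

/-- The majorant of `|x - y|⁻¹ |y|^{-3/2}` near the singularities `0` and `x`. -/
noncomputable def singularMajorant (R : ℝ) (x y : Plane) : ℝ :=
  2 / ‖x‖ * cutPower (3 / 2) R ‖y‖ + (2 / ‖x‖) ^ (3 / 2 : ℝ) * cutPower 1 (R + ‖x‖) ‖x - y‖

theorem singularMajorant_nonneg (R : ℝ) (x y : Plane) : 0 ≤ singularMajorant R x y :=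
  add_nonneg (mul_nonneg (by positivity) (cutPower_nonneg (norm_nonneg _)))
    (mul_nonneg (by positivity) (cutPower_nonneg (norm_nonneg _)))

theorem le_singularMajorant {R : ℝ} {x y : Plane} (hx : x ≠ 0) (hy : ‖y‖ < R) :
    ‖x - y‖⁻¹ * ‖y‖ ^ (-(3 / 2) : ℝ) ≤ singularMajorant R x y := by
  have h := inv_mul_rpow_le (norm_pos_iff.2 hx) (norm_nonneg (x - y)) (norm_nonneg y)
    (by simpa using norm_add_le (x - y) y)
  rw [singularMajorant, cutPower_of_lt hy,
    cutPower_of_lt (by linarith [norm_sub_le x y]), Real.rpow_neg_one]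
  exact h

theorem integrable_singularMajorant {R : ℝ} (hR : 0 < R) (x : Plane) :
    Integrable (singularMajorant R x) :=
  ((integrable_cutPower (by norm_num) hR).const_mul _).add
    (((integrable_cutPower (s := 1) (by norm_num) (by positivity)).comp_sub_left x).const_mul _)

theorem integral_singularMajorant {R : ℝ} (hR : 0 < R) (x : Plane) :
    ∫ y, singularMajorant R x y =
      2 * (volume : Measure Plane).real (Metric.ball 0 1) *
        (2 / ‖x‖ * (2 * R ^ (1 / 2 : ℝ)) + (2 / ‖x‖) ^ (3 / 2 : ℝ) * (R + ‖x‖)) := by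
  have hR' : 0 < R + ‖x‖ := by positivity
  unfold singularMajorant
  rw [integral_add ((integrable_cutPower (by norm_num) hR).const_mul _)
    (((integrable_cutPower (s := 1) (by norm_num) hR').comp_sub_left x).const_mul _),
    integral_const_mul, integral_const_mul,
    integral_sub_left_eq_self (fun y : Plane => cutPower 1 (R + ‖x‖) ‖y‖) volume x,
    integral_cutPower (by norm_num) hR, integral_cutPower (by norm_num) hR',
    show (2 : ℝ) - 3 / 2 = 1 / 2 by norm_num, show (2 : ℝ) - 1 = 1 by norm_num, Real.rpow_one]
  ring

/-! ### The velocity as an absolutely convergent integral -/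

theorem integrable_velocity_integrand (α : ℝ) {x : Plane} (hx : x ≠ 0) :
    Integrable fun y => vecScalar (biotSavartKernel (x - y)) (omegaPlus α y) := by
  obtain ⟨B, hB0, hB⟩ := exists_inv_mul_log_le α
  refine ((integrable_singularMajorant (R := 1 / 3) (by norm_num) x).const_mul
    ((2 * Real.pi)⁻¹ * B)).mono' ?_ (.of_forall fun y => ?_)
  · exact measurable_biotSavartKernel.aestronglyMeasurable.convolution_integrand_swap_snd _
      (measurable_omegaPlus α).aestronglyMeasurable x
  have hpi := Real.pi_pos
  rw [vecScalar_apply, norm_smul, norm_biotSavartKernel,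
    Real.norm_of_nonneg (omegaPlus_nonneg α y)]
  by_cases hy : y ∈ upperHalfDisk (1 / 3)
  · rw [omegaPlus, Set.indicator_of_mem hy]
    obtain ⟨h1, h2⟩ := mem_upperHalfDisk.1 hy
    calc (‖y‖ * |Real.log ‖y‖| ^ α)⁻¹ * ((2 * Real.pi)⁻¹ * ‖x - y‖⁻¹)
        ≤ (B * ‖y‖ ^ (-(3 / 2) : ℝ)) * ((2 * Real.pi)⁻¹ * ‖x - y‖⁻¹) := by
          gcongr
          exact hB _ (norm_pos_of_upper h2) h1
      _ = (2 * Real.pi)⁻¹ * B * (‖x - y‖⁻¹ * ‖y‖ ^ (-(3 / 2) : ℝ)) := by ring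
      _ ≤ _ := by
          gcongr
          exact le_singularMajorant hx h1
  · rw [omegaPlus, Set.indicator_of_notMem hy, zero_mul]
    exact mul_nonneg (by positivity) (singularMajorant_nonneg _ _ _)

theorem convolutionExistsAt_velocity (α : ℝ) {x : Plane} (hx : x ≠ 0) :
    ConvolutionExistsAt biotSavartKernel (omegaPlus α) x vecScalar volume :=
  convolutionExistsAt_iff_integrable_swap.2 (integrable_velocity_integrand α hx)

theorem aestronglyMeasurable_velocity (α : ℝ) :
    AEStronglyMeasurable (velocity (omegaPlus α)) volume :=
  AEStronglyMeasurable.integral_prod_right'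
    (measurable_biotSavartKernel.aestronglyMeasurable.convolution_integrand vecScalar
      (measurable_omegaPlus α).aestronglyMeasurable)

theorem velocity_integrand_zero (α : ℝ) (x y : Plane) :
    vecScalar (biotSavartKernel (x - y)) (omegaPlus α y) 0 =
      (2 * Real.pi)⁻¹ * ((y 1 - x 1) / ‖x - y‖ ^ 2 * omegaPlus α y) := by
  rw [vecScalar_apply, PiLp.smul_apply, biotSavartKernel_zero, PiLp.sub_apply, smul_eq_mul]
  ring

theorem integrable_velocity_zero (α : ℝ) {x : Plane} (hx : x ≠ 0) :
    Integrable fun y => (y 1 - x 1) / ‖x - y‖ ^ 2 * omegaPlus α y := by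
  refine (((EuclideanSpace.proj (𝕜 := ℝ) (0 : Fin 2)).integrable_comp
    (integrable_velocity_integrand α hx)).const_mul (2 * Real.pi)).congr (.of_forall fun y => ?_)
  have hpi := Real.pi_pos.ne'
  change 2 * Real.pi * vecScalar (biotSavartKernel (x - y)) (omegaPlus α y) 0 = _
  rw [velocity_integrand_zero]
  field_simp

theorem velocity_zero (α : ℝ) {x : Plane} (hx : x ≠ 0) :
    velocity (omegaPlus α) x 0 =
      (2 * Real.pi)⁻¹ * ∫ y, (y 1 - x 1) / ‖x - y‖ ^ 2 * omegaPlus α y := by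
  rw [velocity, convolution_eq_swap, ← integral_const_mul,
    ← integral_congr_ae (.of_forall (velocity_integrand_zero α x))]
  exact ((EuclideanSpace.proj (𝕜 := ℝ) (0 : Fin 2)).integral_comp_comm
    (integrable_velocity_integrand α hx)).symm

/-! ### Logarithmic lower bound for the first velocity component -/

/-- The vorticity away from the origin, with the decay `r⁻²` of the far-field kernel. -/
noncomputable def farProfile (α R : ℝ) : ℝ → ℝ :=
  (Set.Ico R (1 / 3)).indicator fun r => (r ^ 2)⁻¹ * (r * |Real.log r| ^ α)⁻¹

theorem measurable_abs_log_rpow (α : ℝ) : Measurable fun r => |Real.log r| ^ α :=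
  (continuous_abs.measurable.comp Real.measurable_log).pow_const α

theorem measurable_farProfile (α R : ℝ) : Measurable (farProfile α R) := by
  have := measurable_abs_log_rpow α
  exact Measurable.indicator (by fun_prop) measurableSet_Ico

theorem farProfile_nonneg (α : ℝ) {R r : ℝ} (hr : 0 ≤ r) : 0 ≤ farProfile α R r :=
  Set.indicator_apply_nonneg fun _ => by positivity

theorem sq_mul_farProfile {α R r : ℝ} (hr : 0 < r) :
    r * (r * farProfile α R r) =
      (Set.Ico R (1 / 3)).indicator (fun r => r⁻¹ * |Real.log r| ^ (-α)) r := by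
  unfold farProfile
  by_cases h : r ∈ Set.Ico R (1 / 3)
  · simp only [Set.indicator_of_mem h]
    rw [Real.rpow_neg (abs_nonneg _)]
    field_simp
  · simp only [Set.indicator_of_notMem h, mul_zero]

theorem Ioi_inter_Ico_eq {R : ℝ} (hR : 0 < R) (a : ℝ) :
    Set.Ioi 0 ∩ Set.Ico R a = Set.Ico R a :=
  Set.inter_eq_right.2 fun _ hr => hR.trans_le hr.1

theorem integrable_farProfile (α : ℝ) {R : ℝ} (hR : 0 < R) :
    Integrable fun z : Plane => ‖z‖ * farProfile α R ‖z‖ := by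
  have h : Set.EqOn (fun r => r * (r * farProfile α R r))
      ((Set.Ico R (1 / 3)).indicator fun r => r⁻¹ * |Real.log r| ^ (-α)) (Set.Ioi 0) :=
    fun r hr => sq_mul_farProfile hr
  rw [integrable_radial_iff (f := fun r => r * farProfile α R r),
    integrableOn_congr_fun h measurableSet_Ioi,
    IntegrableOn, integrable_indicator_iff measurableSet_Ico, IntegrableOn,
    Measure.restrict_restrict measurableSet_Ico, Set.inter_comm, Ioi_inter_Ico_eq hR]
  exact ((continuousOn_inv_mul_log hR).integrableOn_Icc).mono_set Set.Ico_subset_Icc_self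

theorem integral_farProfile {α R : ℝ} (hα : α < 1) (hR : 0 < R) (hR' : R ≤ 1 / 3) :
    ∫ z : Plane, ‖z‖ * farProfile α R ‖z‖ =
      2 * (volume : Measure Plane).real (Metric.ball 0 1) *
        (((-Real.log R) ^ (1 - α) - Real.log 3 ^ (1 - α)) / (1 - α)) := by
  rw [integral_radial (fun r => r * farProfile α R r),
    setIntegral_congr_fun measurableSet_Ioi (fun r hr => sq_mul_farProfile hr),
    setIntegral_indicator measurableSet_Ico, Ioi_inter_Ico_eq hR, integral_Ico_eq_integral_Ioc,
    ← intervalIntegral.integral_of_le hR', integral_inv_mul_log hα hR hR']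

/-- One pointwise inequality covers every `y`, so it can be integrated at once: the profile terms
vanish for `‖y‖ < 10‖x‖`, and beyond that the subtracted majorant only helps. -/
theorem kernel_mul_omegaPlus_ge {α : ℝ} {x : Plane} (hx : x ≠ 0) (hR : 10 * ‖x‖ < 1)
    (hα : 2 * |α| ≤ -Real.log (10 * ‖x‖)) (y : Plane) :
    100 / 121 * {z : Plane | 0 < z 1}.indicator
        (fun z => z 1 * farProfile α (10 * ‖x‖) ‖z‖) y
      - 10 / 81 * {z : Plane | 0 < z 1}.indicator
        (fun z => ‖z‖ * farProfile α (10 * ‖x‖) ‖z‖) y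
      - (10 * ‖x‖) ^ (1 / 2 : ℝ) * (-Real.log (10 * ‖x‖)) ^ (-α) *
        singularMajorant (10 * ‖x‖) x y
    ≤ (y 1 - x 1) / ‖x - y‖ ^ 2 * omegaPlus α y := by
  set R := 10 * ‖x‖ with hRdef
  set B := R ^ (1 / 2 : ℝ) * (-Real.log R) ^ (-α) with hBdef
  have hx0 := norm_pos_iff.2 hx
  have hB : 0 ≤ B :=
    mul_nonneg (by positivity) (Real.rpow_nonneg (by linarith [abs_nonneg α]) _)
  have hM := mul_nonneg hB (singularMajorant_nonneg R x y)
  by_cases hy1 : y ∈ {z : Plane | 0 < z 1}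
  swap
  · have : y ∉ upperHalfDisk (1 / 3) := fun h => hy1 h.2
    rw [omegaPlus, Set.indicator_of_notMem this]
    simp only [Set.indicator_of_notMem hy1]
    linarith
  have hy1' : 0 < y 1 := hy1
  have hn := norm_pos_of_upper hy1'
  simp only [Set.indicator_of_mem hy1]
  by_cases hy : ‖y‖ < 1 / 3
  swap
  · have h1 : y ∉ upperHalfDisk (1 / 3) := fun h => hy (mem_upperHalfDisk.1 h).1
    have h2 : ‖y‖ ∉ Set.Ico R (1 / 3) := fun h => hy h.2
    rw [omegaPlus, Set.indicator_of_notMem h1, farProfile, Set.indicator_of_notMem h2]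
    linarith
  rw [omegaPlus, Set.indicator_of_mem (mem_upperHalfDisk.2 ⟨hy, hy1'⟩), farProfile]
  set w := (‖y‖ * |Real.log ‖y‖| ^ α)⁻¹ with hw
  have hw0 : 0 ≤ w := by positivity
  rcases lt_or_ge ‖y‖ R with hyR | hyR
  · rw [Set.indicator_of_notMem (fun h => absurd h.1 (not_le.2 hyR))]
    have hk : -‖x - y‖⁻¹ ≤ (y 1 - x 1) / ‖x - y‖ ^ 2 := by
      have h1 := abs_apply_le_norm (x - y) 1
      rw [PiLp.sub_apply] at h1
      rcases (norm_nonneg (x - y)).eq_or_lt with h | h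
      -- At `y = x` both sides are `0` by the convention for division by zero.
      · simp [← h]
      · rw [le_div_iff₀ (by positivity)]
        have : -‖x - y‖⁻¹ * ‖x - y‖ ^ 2 = -‖x - y‖ := by field_simp
        linarith [le_abs_self (x 1 - y 1)]
    have hwB := inv_mul_log_le hn hyR.le hR hα
    have : ‖x - y‖⁻¹ * w ≤ B * singularMajorant R x y :=
      calc ‖x - y‖⁻¹ * w ≤ ‖x - y‖⁻¹ * (B * ‖y‖ ^ (-(3 / 2) : ℝ)) := by gcongr
        _ = B * (‖x - y‖⁻¹ * ‖y‖ ^ (-(3 / 2) : ℝ)) := by ring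
        _ ≤ _ := by gcongr; exact le_singularMajorant hx hyR
    nlinarith [mul_le_mul_of_nonneg_right hk hw0]
  · rw [Set.indicator_of_mem (show ‖y‖ ∈ Set.Ico R (1 / 3) from ⟨hyR, hy⟩), ← hw]
    have hf := far_kernel_ge (d := ‖x - y‖) hn hyR hy1'.le (abs_apply_le_norm x 1)
      (by rw [norm_sub_rev]; exact norm_sub_norm_le y x)
      (by linarith [norm_sub_le x y])
    have e : 100 / 121 * (y 1 * ((‖y‖ ^ 2)⁻¹ * w)) - 10 / 81 * (‖y‖ * ((‖y‖ ^ 2)⁻¹ * w)) =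
        (100 / 121 * (y 1 / ‖y‖ ^ 2) - 10 / 81 * ‖y‖⁻¹) * w := by
      field_simp
    linarith [mul_le_mul_of_nonneg_right hf hw0]

/-- All powers of `ρ` cancel because `|x - y|⁻¹ |y|^(-3/2)` integrates over the scale `ρ` to a
multiple of `ρ^(-1/2)`. -/
theorem singular_error_eq {ρ l : ℝ} (hρ : 0 < ρ) :
    (10 * ρ) ^ (1 / 2 : ℝ) * l * (2 / ρ * (2 * (10 * ρ) ^ (1 / 2 : ℝ)) +
      (2 / ρ) ^ (3 / 2 : ℝ) * (10 * ρ + ρ)) = (40 + 22 * (20 : ℝ) ^ (1 / 2 : ℝ)) * l := by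
  have h1 : (10 * ρ) ^ (1 / 2 : ℝ) * (10 * ρ) ^ (1 / 2 : ℝ) = 10 * ρ := by
    rw [← Real.rpow_add (by positivity)]; norm_num
  have h2 : (10 * ρ) ^ (1 / 2 : ℝ) * (2 / ρ) ^ (1 / 2 : ℝ) = (20 : ℝ) ^ (1 / 2 : ℝ) := by
    rw [← Real.mul_rpow (by positivity) (by positivity)]
    congr 1
    field_simp
    norm_num
  have h3 : (2 / ρ) ^ (3 / 2 : ℝ) = 2 / ρ * (2 / ρ) ^ (1 / 2 : ℝ) := by
    rw [show (3 / 2 : ℝ) = 1 + 1 / 2 by norm_num, Real.rpow_add (by positivity), Real.rpow_one]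
  rw [h3]
  calc _ = 4 / ρ * l * ((10 * ρ) ^ (1 / 2 : ℝ) * (10 * ρ) ^ (1 / 2 : ℝ)) +
        22 * l * (ρ * ρ⁻¹) * ((10 * ρ) ^ (1 / 2 : ℝ) * (2 / ρ) ^ (1 / 2 : ℝ)) := by ring
    _ = _ := by rw [h1, h2]; field_simp; ring

theorem velocity_zero_ge {α : ℝ} (hα : α < 1) {x : Plane} (hx : x ≠ 0)
    (hR : 10 * ‖x‖ ≤ 1 / 3) (hα' : 2 * |α| ≤ -Real.log (10 * ‖x‖)) :
    Real.pi⁻¹ * (volume : Measure Plane).real (Metric.ball 0 1) *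
      (1420 / 9801 / (1 - α) * ((-Real.log (10 * ‖x‖)) ^ (1 - α) - Real.log 3 ^ (1 - α)) -
        (40 + 22 * (20 : ℝ) ^ (1 / 2 : ℝ)) * (-Real.log (10 * ‖x‖)) ^ (-α)) ≤
      velocity (omegaPlus α) x 0 := by
  have hx0 := norm_pos_iff.2 hx
  have hpi := Real.pi_pos
  have hpos : 0 < 10 * ‖x‖ := by positivity
  have hm := measurable_farProfile α (10 * ‖x‖)
  have hF := integrable_farProfile α hpos
  have hf0 : ∀ r, 0 ≤ r → 0 ≤ farProfile α (10 * ‖x‖) r := fun r hr => farProfile_nonneg α hr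
  have hi1 : Integrable ({z : Plane | 0 < z 1}.indicator
      fun z => z 1 * farProfile α (10 * ‖x‖) ‖z‖) := by
    refine Integrable.indicator ?_ measurableSet_upper
    refine hF.mono (by fun_prop) (.of_forall fun z => ?_)
    rw [norm_mul, norm_mul, norm_norm]
    exact mul_le_mul_of_nonneg_right (abs_apply_le_norm z 1) (norm_nonneg _)
  have hi2 := hF.indicator measurableSet_upper
  have hi3 := integrable_singularMajorant hpos x
  have h := integral_mono (((hi1.const_mul (100 / 121)).sub (hi2.const_mul (10 / 81))).sub
    (hi3.const_mul ((10 * ‖x‖) ^ (1 / 2 : ℝ) * (-Real.log (10 * ‖x‖)) ^ (-α))))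
    (integrable_velocity_zero α hx)
    (kernel_mul_omegaPlus_ge hx (by linarith) hα')
  rw [integral_sub' ((hi1.const_mul (100 / 121)).sub (hi2.const_mul (10 / 81))) (hi3.const_mul _),
    integral_sub' (hi1.const_mul (100 / 121)) (hi2.const_mul (10 / 81)), integral_const_mul,
    integral_const_mul, integral_const_mul, integral_singularMajorant hpos] at h
  have h1 := integral_upper_mul_ge hf0 hm hF
  have h2 := integral_upper_le (f := fun r => r * farProfile α (10 * ‖x‖) r)
    (fun r hr => mul_nonneg hr (hf0 r hr)) hF
  rw [integral_farProfile hα hpos hR] at h1 h2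
  rw [velocity_zero α hx]
  have e := singular_error_eq (l := (-Real.log (10 * ‖x‖)) ^ (-α)) hx0
  set V := (volume : Measure Plane).real (Metric.ball 0 1)
  -- The net main constant is `(1/4)(100/121) - (1/2)(10/81) = 1420/9801`.
  calc _ = (2 * Real.pi)⁻¹ * ((25 / 121 - 5 / 81) * (2 * V *
          (((-Real.log (10 * ‖x‖)) ^ (1 - α) - Real.log 3 ^ (1 - α)) / (1 - α))) -
          2 * V * ((40 + 22 * (20 : ℝ) ^ (1 / 2 : ℝ)) * (-Real.log (10 * ‖x‖)) ^ (-α))) := by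
        field_simp
        ring
    _ ≤ _ := by
        gcongr
        rw [← e]
        linarith

theorem exists_velocity_zero_ge {α : ℝ} (hα : α < 1) :
    ∃ C > 0, ∃ r₀ > 0, ∀ x ∈ upperHalfDisk r₀,
      C * |Real.log ‖x‖| ^ (1 - α) ≤ velocity (omegaPlus α) x 0 := by
  have hc : 0 < 1420 / 9801 / (1 - α) := by
    have : 0 < 1 - α := by linarith
    positivity
  have hV := volume_unitBall_pos
  have hpi := Real.pi_pos
  obtain ⟨Λ₀, -, hΛ⟩ := exists_log_dominates (k := Real.log 3 ^ (1 - α))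
    (D := 40 + 22 * (20 : ℝ) ^ (1 / 2 : ℝ)) hα hc
  -- The three thresholds make the main term dominate, allow the logarithm to be frozen, and give
  -- `-log (10‖x‖) ≥ -log ‖x‖ / 2`.
  set M := max (max Λ₀ (2 * |α|)) (Real.log 10) with hM
  refine ⟨Real.pi⁻¹ * (volume : Measure Plane).real (Metric.ball 0 1) *
    (1420 / 9801 / (1 - α) / 2 * (1 / 2) ^ (1 - α)), by positivity, Real.exp (-M) / 10,
    by positivity, fun x hx => ?_⟩
  obtain ⟨hx1, hx2⟩ := mem_upperHalfDisk.1 hx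
  have hx0 := norm_pos_of_upper hx2
  have hR0 : 0 < 10 * ‖x‖ := by positivity
  have hlog : M ≤ -Real.log (10 * ‖x‖) := by
    have := Real.log_lt_log hR0 (show 10 * ‖x‖ < Real.exp (-M) by linarith)
    rw [Real.log_exp] at this
    linarith
  have hM1 : Λ₀ ≤ M := (le_max_left _ _).trans (le_max_left _ _)
  have hM2 : 2 * |α| ≤ M := (le_max_right _ _).trans (le_max_left _ _)
  have hM3 : Real.log 10 ≤ M := le_max_right _ _
  have hR : 10 * ‖x‖ ≤ 1 / 10 := by
    rw [← Real.log_le_log_iff hR0 (by norm_num), one_div, Real.log_inv]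
    linarith
  have hL : Real.log (10 * ‖x‖) = Real.log 10 + Real.log ‖x‖ :=
    Real.log_mul (by norm_num) hx0.ne'
  have hlog1 : 0 ≤ -Real.log ‖x‖ := neg_nonneg.2 (Real.log_nonpos hx0.le (by linarith))
  refine le_trans ?_ (velocity_zero_ge hα (norm_pos_iff.1 hx0) (by linarith) (hM2.trans hlog))
  rw [mul_assoc]
  refine mul_le_mul_of_nonneg_left ?_ (by positivity)
  refine le_trans ?_ (hΛ _ (hM1.trans hlog))
  rw [mul_assoc, abs_of_nonpos (by linarith), ← Real.mul_rpow (by norm_num) hlog1]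
  have : 1 / 2 * -Real.log ‖x‖ ≤ -Real.log (10 * ‖x‖) := by linarith
  gcongr

/-! ### Unboundedness and failure of local integrability -/

theorem volume_upperHalfDisk_pos {r : ℝ} (hr : 0 < r) : 0 < volume (upperHalfDisk r) := by
  have ho : IsOpen (upperHalfDisk r) :=
    Metric.isOpen_ball.inter (isOpen_lt continuous_const (by fun_prop))
  refine ho.measure_pos _ ⟨EuclideanSpace.single 1 (r / 2), mem_upperHalfDisk.2 ⟨?_, ?_⟩⟩
  · rw [PiLp.norm_single, Real.norm_of_nonneg (by positivity)]
    linarith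
  · simpa using hr

theorem upperHalfDisk_subset {r s : ℝ} (h : r ≤ s) : upperHalfDisk r ⊆ upperHalfDisk s :=
  Set.inter_subset_inter_left _ (Metric.ball_subset_ball h)

theorem eLpNorm_top_eq_top_of_log_le {u : Plane → Plane} {C r₀ β : ℝ} (hC : 0 < C) (hr₀ : 0 < r₀)
    (hβ : 0 < β) (h : ∀ x ∈ upperHalfDisk r₀, C * |Real.log ‖x‖| ^ β ≤ u x 0) :
    eLpNorm u ∞ volume = ∞ := by
  by_contra hne
  rw [eLpNorm_exponent_top] at hne
  set M := (eLpNormEssSup u volume).toReal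
  have hae : ∀ᵐ x, ‖u x‖ ≤ M := by
    filter_upwards [ae_le_eLpNormEssSup (f := u) (μ := volume)] with x hx
    simpa using ENNReal.toReal_mono hne hx
  have ht : Filter.Tendsto (fun r => C * |Real.log r| ^ β) (nhdsWithin 0 (Set.Ioi 0))
      Filter.atTop :=
    ((tendsto_rpow_atTop hβ).comp
      (Filter.tendsto_abs_atBot_atTop.comp Real.tendsto_log_nhdsGT_zero)).const_mul_atTop hC
  obtain ⟨ε, hε, hlt⟩ := (mem_nhdsGT_iff_exists_Ioo_subset).1 (ht.eventually_gt_atTop M)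
  have hε' : 0 < ε := hε
  -- An essential bound `M` would fail on a whole half-disk, which has positive measure.
  refine (volume_upperHalfDisk_pos (lt_min hε' hr₀)).ne' (measure_mono_null (fun x hx => ?_) hae)
  obtain ⟨h1, h2⟩ := mem_upperHalfDisk.1 hx
  have hb := h x (upperHalfDisk_subset (min_le_right _ _) hx)
  have hM : M < C * |Real.log ‖x‖| ^ β :=
    hlt ⟨norm_pos_of_upper h2, h1.trans_le (min_le_left _ _)⟩
  exact not_le.2 (hM.trans_le (hb.trans ((le_abs_self _).trans (abs_apply_le_norm (u x) 0))))

theorem not_locallyIntegrable_of_log_le {α C r₀ : ℝ} (hα : α ≤ 2 / 3) (hC : 0 < C) (hr₀ : 0 < r₀)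
    {u : Plane → Plane}
    (h : ∀ x ∈ upperHalfDisk r₀, C * |Real.log ‖x‖| ^ (1 - α) ≤ u x 0) :
    ¬ LocallyIntegrable (fun x => |omegaPlus α x| ^ 2 • u x) volume := by
  intro hloc
  set ρ := min r₀ (1 / 3) with hρdef
  have hρ : 0 < ρ := lt_min hr₀ (by norm_num)
  have hρ3 : ρ ≤ 1 / 3 := min_le_right _ _
  have hint : IntegrableOn (fun x => |omegaPlus α x| ^ 2 • u x) (upperHalfDisk ρ) :=
    (hloc.integrableOn_isCompact (isCompact_closedBall (0 : Plane) ρ)).mono_set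
      (Set.inter_subset_left.trans Metric.ball_subset_closedBall)
  -- The exponent is `3` rather than `2` because the half-plane criterion carries the extra weight
  -- `z 1 ≤ ‖z‖`.
  set f : ℝ → ℝ := (Set.Iio ρ).indicator fun r => (r ^ 3)⁻¹ * |Real.log r|⁻¹ with hf
  have hfm : Measurable f := by
    have : Measurable fun r => |Real.log r| := continuous_abs.measurable.comp Real.measurable_log
    exact Measurable.indicator (by fun_prop) measurableSet_Iio
  have hup : Integrable ({z : Plane | 0 < z 1}.indicator fun z => z 1 * f ‖z‖) := by
    refine ((hint.integrable_indicator (measurableSet_upperHalfDisk ρ)).norm.const_mul C⁻¹).mono'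
      (Measurable.aestronglyMeasurable (Measurable.indicator (by fun_prop) measurableSet_upper))
      (.of_forall fun z => ?_)
    by_cases hz1 : z ∈ {z : Plane | 0 < z 1}
    swap
    · rw [Set.indicator_of_notMem hz1, norm_zero]; positivity
    have hz1' : 0 < z 1 := hz1
    rw [Set.indicator_of_mem hz1]
    by_cases hz : ‖z‖ < ρ
    swap
    · rw [hf, Set.indicator_of_notMem (show ‖z‖ ∉ Set.Iio ρ from hz), mul_zero, norm_zero]
      positivity
    have hzρ : z ∈ upperHalfDisk ρ := mem_upperHalfDisk.2 ⟨hz, hz1'⟩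
    have hn := norm_pos_of_upper hz1'
    have hl1 := one_lt_neg_log hn (hz.trans_le hρ3)
    have hl : |Real.log ‖z‖| = -Real.log ‖z‖ := abs_log_of_lt_one hn (by linarith)
    rw [hf, Set.indicator_of_mem (show ‖z‖ ∈ Set.Iio ρ from hz), Set.indicator_of_mem hzρ,
      norm_smul, omegaPlus, Set.indicator_of_mem (upperHalfDisk_subset hρ3 hzρ)]
    have hu := (h z (upperHalfDisk_subset (min_le_left _ _) hzρ)).trans
      ((le_abs_self _).trans (abs_apply_le_norm (u z) 0))
    rw [hl] at hu ⊢
    set t := -Real.log ‖z‖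
    have ht : 0 < t := by linarith
    rw [Real.norm_of_nonneg (by positivity), Real.norm_of_nonneg (by positivity),
      abs_of_nonneg (by positivity)]
    have hz2 : z 1 ≤ ‖z‖ := (le_abs_self _).trans (abs_apply_le_norm z 1)
    -- Here `t > 1`, and `-1 ≤ 1 - 3α` is exactly `α ≤ 2/3`.
    have e : t⁻¹ ≤ ((t ^ α)⁻¹) ^ 2 * t ^ (1 - α) := by
      rw [← Real.rpow_neg_one, ← Real.rpow_neg ht.le, ← Real.rpow_natCast, ← Real.rpow_mul ht.le,
        ← Real.rpow_add ht]
      exact Real.rpow_le_rpow_of_exponent_le hl1.le (by push_cast; linarith)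
    calc z 1 * ((‖z‖ ^ 3)⁻¹ * t⁻¹) ≤ ‖z‖ * ((‖z‖ ^ 3)⁻¹ * (((t ^ α)⁻¹) ^ 2 * t ^ (1 - α))) := by
          gcongr
      _ = C⁻¹ * ((‖z‖ * t ^ α)⁻¹ ^ 2 * (C * t ^ (1 - α))) := by
          field_simp
      _ ≤ _ := by gcongr
  have hr := integrable_norm_mul_of_upper hfm hup
  rw [integrable_radial_iff (f := fun r => r * f r)] at hr
  refine not_integrableOn_inv_mul_inv_log hρ hρ3
    ((hr.mono_set Set.Ioo_subset_Ioi_self).congr_fun (fun r hr => ?_) measurableSet_Ioo)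
  have hr0 : 0 < r := hr.1
  simp only [hf]
  rw [Set.indicator_of_mem (Set.mem_Iio.2 hr.2),
    abs_log_of_lt_one hr.1 (by linarith [hr.2])]
  field_simp

theorem theorem5p3 :
    (∀ α : ℝ, α < 1 →
      -- the velocity is well defined (absolutely convergent integral) off the origin, measurable,
      (∀ x : Plane, x ≠ 0 →
        ConvolutionExistsAt biotSavartKernel (omegaPlus α) x vecScalar volume) ∧
      AEStronglyMeasurable (velocity (omegaPlus α)) volume ∧
      -- it is (essentially) unbounded,
      eLpNorm (velocity (omegaPlus α)) ∞ volume = ∞ ∧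
      -- with the logarithmic lower bound for its first component
      ∃ C > 0, ∃ r₀ > 0, ∀ x ∈ upperHalfDisk r₀,
        C * |Real.log ‖x‖| ^ (1 - α) ≤ velocity (omegaPlus α) x 0) ∧
    (∀ α : ℝ, 1 / 2 < α → α ≤ 2 / 3 →
      ¬ LocallyIntegrable
        (fun x => |omegaPlus α x| ^ 2 • velocity (omegaPlus α) x) volume) := by
  refine ⟨fun α hα => ?_, fun α _ hα => ?_⟩
  · obtain ⟨C, hC, r₀, hr₀, h⟩ := exists_velocity_zero_ge hα
    exact ⟨fun x hx => convolutionExistsAt_velocity α hx, aestronglyMeasurable_velocity α,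
      eLpNorm_top_eq_top_of_log_le hC hr₀ (by linarith) h, C, hC, r₀, hr₀, h⟩
  · obtain ⟨C, hC, r₀, hr₀, h⟩ := exists_velocity_zero_ge (show α < 1 by linarith)
    exact not_locallyIntegrable_of_log_le hα hC hr₀ h
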